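/- Let $n\ge 1$ be an integer, let $p\in[2,\infty)$ and $\lambda\in[0,4n/p)$, and let $\mathbb{B}^n=\{z\in\mathbb{C}^n: |z|<1\}$ be the open Euclidean unit ball of $\mathbb{C}^n$. Let $f:\mathbb{B}^n\to\mathbb{C}$ be twice continuously differentiable (in the real sense) and satisfy the Yukawa equation $$\Delta f=\lambda f\quad\text{in }\mathbb{B}^n,\qquad \Delta=\sum_{k=1}^n\Big(\frac{\partial^2}{\partial x_k^2}+\frac{\partial^2}{\partial y_k^2}\Big),\quad z_k=x_k+iy_k .$$ Let $f_z=(f_{z_1},\dots,f_{z_n})$ and $f_{\bar z}=(f_{\bar z_1},\dots,f_{\bar z_n})$, where $f_{z_k}=\frac12(f_{x_k}-if_{y_k})$ and $f_{\bar z_k}=\frac12(f_{x_k}+if_{y_k})$, and let $\widetilde{\nabla f}=(f_z,f_{\bar z})$ with $|\widetilde{\nabla f}|=(|f_z|^2+|f_{\bar z}|^2)^{1/2}$. For $0<r<1$ and a continuous complex- or vector-valued function $g$ on $\mathbb{B}^n$ put $$M_p(r,g)=\Big(\int_{\partial\mathbb{B}^n}|g(r\zeta)|^p\,d\sigma(\zeta)\Big)^{1/p},$$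 where $\sigma$ is the Lebesgue surface measure on $\partial\mathbb{B}^n$ normalized to total mass $1$. If $$M_p(r,\widetilde{\nabla f})=O\Big(\frac{1}{1-r}\Big)\quad\text{as } r\to1^-,$$ then $$M_p(r,f)=O\Big(\Big(\log\frac{1}{1-r}\Big)^{1/2}\Big)\quad\text{as } r\to1^-.$$ -/

import Mathlib

open MeasureTheory Filter Asymptotics Topology

noncomputable section

/-- `ℂⁿ` with its Euclidean norm `|z| = (∑ |z_k|²)^{1/2}`. -/
abbrev Cn (n : ℕ) : Type := EuclideanSpace ℂ (Fin n)

/-- `f` solves the Yukawa equation `Δ f = lam • f` in the open unit ball of `ℂⁿ`: it is twice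
continuously differentiable there (in the real sense), and the equation holds at every point of
the ball. Here `Laplacian.laplacian` is the Laplacian of the real inner product space
`ℂⁿ = ℝ²ⁿ`, that is `∑ k, (∂²/∂x_k² + ∂²/∂y_k²)`. -/
def IsYukawaSolution {n : ℕ} (lam : ℝ) (f : Cn n → ℂ) : Prop :=
  ContDiffOn ℝ 2 f (Metric.ball 0 1) ∧
    ∀ z ∈ Metric.ball (0 : Cn n) 1, Laplacian.laplacian f z = (lam : ℂ) * f z

/-- `∂f/∂x_k`, where `z_k = x_k + i y_k`. -/
def partialX {n : ℕ} (f : Cn n → ℂ) (k : Fin n) (z : Cn n) : ℂ :=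
  fderiv ℝ f z (EuclideanSpace.single k 1)

/-- `∂f/∂y_k`, where `z_k = x_k + i y_k`. -/
def partialY {n : ℕ} (f : Cn n → ℂ) (k : Fin n) (z : Cn n) : ℂ :=
  fderiv ℝ f z (EuclideanSpace.single k Complex.I)

/-- The vector `f_z` of the derivatives `∂f/∂z_k = (∂f/∂x_k - i ∂f/∂y_k) / 2`. -/
def wirtinger {n : ℕ} (f : Cn n → ℂ) (z : Cn n) : Cn n :=
  WithLp.toLp 2 fun k => (partialX f k z - Complex.I * partialY f k z) / 2

/-- The vector `f_{z̄}` of the derivatives `∂f/∂z̄_k = (∂f/∂x_k + i ∂f/∂y_k) / 2`. -/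
def wirtingerConj {n : ℕ} (f : Cn n → ℂ) (z : Cn n) : Cn n :=
  WithLp.toLp 2 fun k => (partialX f k z + Complex.I * partialY f k z) / 2

/-- The complex gradient `(f_z, f_{z̄})`. The norm of `WithLp 2 (_ × _)` is the Hilbert-Schmidt
norm `(|f_z|² + |f_{z̄}|²)^{1/2}`. -/
def complexGradient {n : ℕ} (f : Cn n → ℂ) (z : Cn n) : WithLp 2 (Cn n × Cn n) :=
  WithLp.toLp 2 (wirtinger f z, wirtingerConj f z)

/-- The Lebesgue surface measure on the unit sphere of `ℂⁿ`, normalized to total mass one. -/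
def sphereMeasure (n : ℕ) : Measure (Metric.sphere (0 : Cn n) 1) :=
  ((volume : Measure (Cn n)).toSphere Set.univ)⁻¹ • (volume : Measure (Cn n)).toSphere

/-- The integral mean `M_p(r, g) = (∫ |g(r ζ)|^p dσ(ζ))^{1/p}` over the unit sphere of `ℂⁿ`. -/
def integralMean {n : ℕ} {F : Type*} [NormedAddCommGroup F] (p r : ℝ) (g : Cn n → F) : ℝ :=
  (∫ ζ : Metric.sphere (0 : Cn n) 1, ‖g (r • (ζ : Cn n))‖ ^ p ∂(sphereMeasure n)) ^ (1 / p)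

end

/-!
Fix `p = 2q` with `q ≥ 1`. The function `Φ = (‖f‖² + 1) ^ q` is `C²` and, because `Δ f = lam f`
with `lam ≥ 0`, it is subharmonic with
`Δ Φ ≤ 2q(2q - 1) (‖f‖² + 1) ^ (q - 1) |∇f|² + 2q lam Φ` (`covectorDiv_fderiv_regPow_bounds`).
Let `φ r` be the mean of `Φ` over the sphere of radius `r`, and let `N` be the real dimension of
the space. The divergence theorem on balls (`flux_sphere_eq`) says
`r ^ (N - 1) φ' r = ∫ s in 0..r, s ^ (N - 1) * (mean of Δ Φ over the sphere of radius s)`.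
Hence `φ` is nondecreasing. Hölder's inequality and the bound `K / (1 - s) ^ 2` for the
`L^q`-norm of `|∇f|²` on the sphere of radius `s` bound the integrand, and since
`∫ s in 0..r, (1 - s)⁻² ≤ (1 - r)⁻¹`, this gives
`φ' ≤ A φ ^ (1 - 1/q) / (1 - r) + B φ`. For `y = φ ^ (1/q)` the inequality is linear,
`y' ≤ (A/q) / (1 - r) + (B/q) y`, so `y = O (log (1 / (1 - r)))`
(`rpow_le_log_of_deriv_le`). As `M_p(r, f) ≤ y ^ (1/2)`, the claim follows.

The divergence theorem on balls is obtained from integration by parts on the whole space against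
radial cutoffs, polar coordinates, and the fundamental lemma of the calculus of variations.
-/

/-! ### Polar coordinates and the divergence theorem on balls -/

section Divergence

variable {E : Type*} [NormedAddCommGroup E] [InnerProductSpace ℝ E]

/-- The divergence of the covector field `ω`, computed in the orthonormal basis `e`. -/
noncomputable def covectorDiv {ι : Type*} [Fintype ι] (e : OrthonormalBasis ι ℝ E)
    (ω : E → E →L[ℝ] ℝ) (x : E) : ℝ :=
  ∑ i, fderiv ℝ ω x (e i) (e i)

lemma continuous_covectorDiv {ι : Type*} [Fintype ι] (e : OrthonormalBasis ι ℝ E)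
    {ω : E → E →L[ℝ] ℝ} (hω : ContDiff ℝ 1 ω) : Continuous (covectorDiv e ω) := by
  have h := hω.continuous_fderiv one_ne_zero
  unfold covectorDiv
  fun_prop

variable [FiniteDimensional ℝ E] [MeasurableSpace E] [BorelSpace E]

/-- Integration in polar coordinates. -/
lemma integral_eq_integral_Ioi_integral_sphere [Nontrivial E] (μ : Measure E)
    [μ.IsAddHaarMeasure] {F : E → ℝ} (hF : Integrable F μ) :
    ∫ x, F x ∂μ = ∫ r in Set.Ioi (0 : ℝ), r ^ (Module.finrank ℝ E - 1) *
      ∫ ζ : Metric.sphere (0 : E) 1, F (r • (ζ : E)) ∂μ.toSphere := by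
  have hmp := μ.measurePreserving_homeomorphUnitSphereProd
  have hemb := (homeomorphUnitSphereProd E).measurableEmbedding
  let G : Metric.sphere (0 : E) 1 × Set.Ioi (0 : ℝ) → ℝ := fun p => F ((p.2 : ℝ) • (p.1 : E))
  have hG : ∀ x : ({0}ᶜ : Set E), G (homeomorphUnitSphereProd E x) = F x := by
    intro x
    have hx : ‖(x : E)‖ ≠ 0 := norm_ne_zero_iff.2 x.2
    simp [G, homeomorphUnitSphereProd, smul_smul, hx]
  have hGi : Integrable G (μ.toSphere.prod (.volumeIoiPow (Module.finrank ℝ E - 1))) := by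
    rw [← hmp.integrable_comp_emb hemb]
    have : G ∘ homeomorphUnitSphereProd E = fun x : ({0}ᶜ : Set E) => F x := funext hG
    rw [this]
    have h2 : IntegrableOn F ({0}ᶜ) μ := hF.integrableOn
    rwa [integrableOn_iff_comap_subtypeVal (measurableSet_singleton _).compl] at h2
  calc ∫ x, F x ∂μ = ∫ x : ({0}ᶜ : Set E), F x ∂(μ.comap (↑)) := by
        rw [integral_subtype_comap (measurableSet_singleton _).compl F,
          restrict_compl_singleton]
    _ = ∫ p, G p ∂(μ.toSphere.prod (.volumeIoiPow (Module.finrank ℝ E - 1))) := by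
        rw [← hmp.integral_comp hemb]
        simp_rw [hG]
    _ = ∫ r : Set.Ioi (0 : ℝ), ∫ ζ, G (ζ, r) ∂μ.toSphere
          ∂.volumeIoiPow (Module.finrank ℝ E - 1) := integral_prod_symm _ hGi
    _ = _ := by
        simp only [Measure.volumeIoiPow, ENNReal.ofReal, G]
        rw [integral_withDensity_eq_integral_smul,
          integral_subtype_comap measurableSet_Ioi fun a ↦
            Real.toNNReal (a ^ (Module.finrank ℝ E - 1)) •
              ∫ ζ : Metric.sphere (0 : E) 1, F (a • (ζ : E)) ∂μ.toSphere,
          setIntegral_congr_fun measurableSet_Ioi fun x hx ↦ ?_]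
        · rw [NNReal.smul_def, Real.coe_toNNReal _ (pow_nonneg (le_of_lt hx) _), smul_eq_mul]
        · exact (measurable_subtype_coe.pow_const _).real_toNNReal

/-- The divergence theorem tested against a radial cutoff `x ↦ H (‖x‖ ^ 2)`. -/
lemma integral_radial_mul_covectorDiv (μ : Measure E) [μ.IsAddHaarMeasure]
    {ι : Type*} [Fintype ι] (e : OrthonormalBasis ι ℝ E)
    {ω : E → E →L[ℝ] ℝ} (hω : ContDiff ℝ 1 ω) {H m : ℝ → ℝ} (hm : Continuous m)
    (hH : ∀ u, HasDerivAt H (m u) u)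
    (hHs : HasCompactSupport fun x : E => H (‖x‖ ^ 2)) :
    ∫ x, H (‖x‖ ^ 2) * covectorDiv e ω x ∂μ = - ∫ x, 2 * m (‖x‖ ^ 2) * ω x x ∂μ := by
  set ψ : E → ℝ := fun x => H (‖x‖ ^ 2) with hψ
  have hψd : ∀ x, HasFDerivAt ψ ((2 * m (‖x‖ ^ 2)) • innerSL ℝ x) x := by
    intro x
    have h1 : HasFDerivAt (fun x : E => ‖x‖ ^ 2) (2 • innerSL ℝ x) x :=
      (hasStrictFDerivAt_norm_sq x).hasFDerivAt
    have := (hH (‖x‖ ^ 2)).comp_hasFDerivAt x h1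
    refine this.congr_fderiv ?_
    ext v
    simp; ring
  have hψc : Continuous ψ := continuous_iff_continuousAt.2 fun x => (hψd x).continuousAt
  have hψf : ∀ x v, fderiv ℝ ψ x v = 2 * m (‖x‖ ^ 2) * inner ℝ x v := by
    intro x v; rw [(hψd x).fderiv]; simp
  have hωc := hω.continuous
  have hωf := hω.continuous_fderiv one_ne_zero
  have hωi : ∀ i x, fderiv ℝ (fun x => ω x (e i)) x (e i) = fderiv ℝ ω x (e i) (e i) := by
    intro i x
    have h1 : HasFDerivAt ω (fderiv ℝ ω x) x :=
      (hω.differentiable one_ne_zero x).hasFDerivAt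
    rw [(h1.clm_apply (hasFDerivAt_const (e i) x)).fderiv]
    simp
  have hfs : HasCompactSupport (fderiv ℝ ψ) := hHs.fderiv ℝ
  have hI1 : ∀ i, Integrable (fun x => ψ x * fderiv ℝ ω x (e i) (e i)) μ := fun i =>
    Continuous.integrable_of_hasCompactSupport (by fun_prop) hHs.mul_right
  have hI2 : ∀ i, Integrable (fun x => fderiv ℝ ψ x (e i) * ω x (e i)) μ := fun i => by
    refine Continuous.integrable_of_hasCompactSupport ?_ ?_
    · simp_rw [hψf]; fun_prop
    · refine HasCompactSupport.mul_right (f := fun x => fderiv ℝ ψ x (e i)) ?_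
      exact hfs.comp_left (g := fun L : E →L[ℝ] ℝ => L (e i)) (by simp)
  have key : ∀ i, ∫ x, ψ x * fderiv ℝ ω x (e i) (e i) ∂μ
      = - ∫ x, fderiv ℝ ψ x (e i) * ω x (e i) ∂μ := by
    intro i
    simp_rw [← hωi]
    refine integral_mul_fderiv_eq_neg_fderiv_mul_of_integrable (hI2 i) ?_ ?_ ?_ ?_
    · simpa only [hωi] using hI1 i
    · exact Continuous.integrable_of_hasCompactSupport (by fun_prop) hHs.mul_right
    · exact fun x _ => (hψd x).differentiableAt
    · intro x _
      exact ((hω.differentiable one_ne_zero).clm_apply (differentiable_const _)) x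
  calc ∫ x, ψ x * covectorDiv e ω x ∂μ
      = ∑ i, ∫ x, ψ x * fderiv ℝ ω x (e i) (e i) ∂μ := by
        rw [← integral_finsetSum _ fun i _ => hI1 i]
        simp_rw [covectorDiv, Finset.mul_sum]
    _ = - ∫ x, ∑ i, fderiv ℝ ψ x (e i) * ω x (e i) ∂μ := by
        rw [integral_finsetSum _ fun i _ => hI2 i]
        simp_rw [key, Finset.sum_neg_distrib]
    _ = _ := by
        congr 2
        ext x
        have hx : ω x x = ∑ i, inner ℝ x (e i) * ω x (e i) := by
          conv_lhs => rw [show ω x x = ω x (∑ i, inner ℝ (e i) x • e i) by rw [e.sum_repr'], map_sum]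
          simp [real_inner_comm]
        rw [hx, Finset.mul_sum]
        simp_rw [hψf, mul_assoc]

lemma continuous_integral_sphere_smul (μ : Measure E) [μ.IsAddHaarMeasure]
    {u : ℝ → E → ℝ} (hu : Continuous (Function.uncurry u)) :
    Continuous fun r : ℝ => ∫ ζ : Metric.sphere (0 : E) 1, u r (ζ : E) ∂μ.toSphere := by
  have := continuous_parametric_integral_of_continuous (μ := μ.toSphere)
    (f := fun (r : ℝ) (ζ : Metric.sphere (0 : E) 1) => u r ζ) (s := Set.univ)
    (by exact hu.comp (by fun_prop : Continuous fun p : ℝ × Metric.sphere (0 : E) 1 =>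
      (p.1, (p.2 : E)))) isCompact_univ
  simpa using this

/-- The divergence theorem on the ball of radius `r` about the origin, in polar coordinates, for
a covector field that is `C¹` on the whole space. -/
lemma flux_sphere_eq_of_contDiff [Nontrivial E] (μ : Measure E) [μ.IsAddHaarMeasure]
    {ι : Type*} [Fintype ι] (e : OrthonormalBasis ι ℝ E)
    {ω : E → E →L[ℝ] ℝ} (hω : ContDiff ℝ 1 ω) {r : ℝ} (hr : 0 < r) :
    r ^ (Module.finrank ℝ E - 1) *
        ∫ ζ : Metric.sphere (0 : E) 1, ω (r • (ζ : E)) ζ ∂μ.toSphere =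
      ∫ s in (0 : ℝ)..r, s ^ (Module.finrank ℝ E - 1) *
        ∫ ζ : Metric.sphere (0 : E) 1, covectorDiv e ω (s • (ζ : E)) ∂μ.toSphere := by
  set N := Module.finrank ℝ E - 1
  set W : ℝ → ℝ := fun r => r ^ N *
        ∫ ζ : Metric.sphere (0 : E) 1, ω (r • (ζ : E)) ζ ∂μ.toSphere with hW
  set V : ℝ → ℝ := fun s => s ^ N *
        ∫ ζ : Metric.sphere (0 : E) 1, covectorDiv e ω (s • (ζ : E)) ∂μ.toSphere with hV
  have hωc := hω.continuous
  have hdc := continuous_covectorDiv e hω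
  have hWc : Continuous W := by
    refine (continuous_id.pow N).mul ?_
    exact continuous_integral_sphere_smul μ (u := fun r x => ω (r • x) x) (by
      unfold Function.uncurry; fun_prop)
  have hVc : Continuous V := by
    refine (continuous_id.pow N).mul ?_
    exact continuous_integral_sphere_smul μ (u := fun r x => covectorDiv e ω (r • x)) (by
      unfold Function.uncurry; fun_prop)
  set P : ℝ → ℝ := fun r => ∫ s in (0 : ℝ)..r, V s with hP
  have hPd : ∀ r, HasDerivAt P (V r) r := fun r =>
    intervalIntegral.integral_hasDerivAt_right (hVc.intervalIntegrable _ _)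
      (hVc.stronglyMeasurableAtFilter _ _) hVc.continuousAt
  have hPc : Continuous P := continuous_iff_continuousAt.2 fun x => (hPd x).continuousAt
  -- It suffices to test `W - P`, read in the variable `u = r ^ 2`, against bump functions.
  set Y : ℝ → ℝ := fun u => W (√u) - P (√u) with hY
  have hYc : Continuous Y := by fun_prop
  have hae : ∀ᵐ u ∂(volume : Measure ℝ), u ∈ Set.Ioi (0 : ℝ) → Y u = 0 := by
    refine isOpen_Ioi.ae_eq_zero_of_integral_contDiff_smul_eq_zero
      (hYc.locallyIntegrable.locallyIntegrableOn _) fun m hm hms hmsub => ?_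
    have hmc := hm.continuous
    obtain ⟨R, hR0, hR⟩ : ∃ R : ℝ, 0 < R ∧ ∀ u, R ≤ u → m u = 0 := by
      obtain ⟨R, hR0, hR⟩ := hms.isCompact.isBounded.subset_closedBall_lt 0 0
      refine ⟨R + 1, by linarith, fun u hu => ?_⟩
      by_contra hne
      have := hR (subset_tsupport _ hne)
      rw [mem_closedBall_zero_iff, Real.norm_eq_abs] at this
      linarith [le_abs_self u]
    set H : ℝ → ℝ := fun u => ∫ t in R..u, m t with hH
    have hHd : ∀ u, HasDerivAt H (m u) u := fun u =>
      intervalIntegral.integral_hasDerivAt_right (hmc.intervalIntegrable _ _)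
        (hmc.stronglyMeasurableAtFilter _ _) hmc.continuousAt
    have hHz : ∀ u, R ≤ u → H u = 0 := by
      intro u hu
      rw [hH]
      refine (intervalIntegral.integral_congr (g := fun _ => (0 : ℝ)) fun t ht => ?_).trans (by simp)
      rw [Set.uIcc_of_le hu] at ht
      exact hR t ht.1
    have hHc : Continuous H := continuous_iff_continuousAt.2 fun x => (hHd x).continuousAt
    have hsq : ∀ t : ℝ, R + 1 ≤ t → R ≤ t ^ 2 := fun t ht => by nlinarith
    have hHs : HasCompactSupport fun x : E => H (‖x‖ ^ 2) := by
      refine HasCompactSupport.intro (isCompact_closedBall (0 : E) (R + 1)) fun x hx => ?_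
      rw [mem_closedBall_zero_iff, not_le] at hx
      exact hHz _ (hsq _ hx.le)
    have hms' : HasCompactSupport fun x : E => m (‖x‖ ^ 2) := by
      refine HasCompactSupport.intro (isCompact_closedBall (0 : E) (R + 1)) fun x hx => ?_
      rw [mem_closedBall_zero_iff, not_le] at hx
      exact hR _ (hsq _ hx.le)
    have hdiv := integral_radial_mul_covectorDiv μ e hω hmc hHd hHs
    have hint1 : Integrable (fun x => H (‖x‖ ^ 2) * covectorDiv e ω x) μ :=
      Continuous.integrable_of_hasCompactSupport (by fun_prop) hHs.mul_right
    have hint2 : Integrable (fun x => 2 * m (‖x‖ ^ 2) * ω x x) μ :=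
      Continuous.integrable_of_hasCompactSupport (by fun_prop)
        (HasCompactSupport.mul_right (f := fun x : E => 2 * m (‖x‖ ^ 2)) hms'.mul_left)
    rw [integral_eq_integral_Ioi_integral_sphere μ hint1,
      integral_eq_integral_Ioi_integral_sphere μ hint2] at hdiv
    have hnorm : ∀ r ∈ Set.Ioi (0 : ℝ), ∀ ζ : Metric.sphere (0 : E) 1, ‖r • (ζ : E)‖ = r := by
      intro r hr ζ
      rw [norm_smul, norm_eq_of_mem_sphere ζ, mul_one, Real.norm_of_nonneg (le_of_lt hr)]
    have e1 : ∫ r in Set.Ioi (0 : ℝ), r ^ N * ∫ ζ : Metric.sphere (0 : E) 1,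
          H (‖r • (ζ : E)‖ ^ 2) * covectorDiv e ω (r • (ζ : E)) ∂μ.toSphere =
        ∫ r in Set.Ioi (0 : ℝ), H (r ^ 2) * V r := by
      refine setIntegral_congr_fun measurableSet_Ioi fun r hr => ?_
      simp only [hnorm r hr, integral_const_mul, hV]
      ring
    have e2 : ∫ r in Set.Ioi (0 : ℝ), r ^ N * ∫ ζ : Metric.sphere (0 : E) 1,
          2 * m (‖r • (ζ : E)‖ ^ 2) * ω (r • (ζ : E)) (r • (ζ : E)) ∂μ.toSphere =
        ∫ r in Set.Ioi (0 : ℝ), 2 * r * m (r ^ 2) * W r := by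
      refine setIntegral_congr_fun measurableSet_Ioi fun r hr => ?_
      simp only [hnorm r hr, map_smul, smul_eq_mul, integral_const_mul, hW]
      ring
    rw [e1, e2] at hdiv
    have hcs : ∀ {g : ℝ → ℝ}, Continuous g → (∀ t, R + 1 ≤ t → g t = 0) →
        IntegrableOn g (Set.Ioi 0) := by
      intro g hg hg0
      have h1 : IntegrableOn g (Set.Ioc 0 (R + 1)) :=
        (hg.continuousOn.integrableOn_Icc).mono_set Set.Ioc_subset_Icc_self
      have h2 : IntegrableOn g (Set.Ioi (R + 1)) :=
        (integrableOn_zero (ε' := ℝ)).congr_fun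
          (fun t ht => (hg0 t (le_of_lt ht)).symm) measurableSet_Ioi
      rw [← Set.Ioc_union_Ioi_eq_Ioi (by linarith : (0 : ℝ) ≤ R + 1)]
      exact h1.union h2
    have i1 : IntegrableOn (fun r => H (r ^ 2) * V r) (Set.Ioi 0) :=
      hcs (by fun_prop) fun t ht => by simp [hHz _ (hsq t ht)]
    have i2 : IntegrableOn (fun r => 2 * r * m (r ^ 2) * W r) (Set.Ioi 0) :=
      hcs (by fun_prop) fun t ht => by simp [hR _ (hsq t ht)]
    have i3 : IntegrableOn (fun r => 2 * r * m (r ^ 2) * P r) (Set.Ioi 0) :=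
      hcs (by fun_prop) fun t ht => by simp [hR _ (hsq t ht)]
    have hparts : ∫ r in Set.Ioi (0 : ℝ), (2 * r * m (r ^ 2) * P r + H (r ^ 2) * V r) = 0 := by
      have hder : ∀ r, HasDerivAt (fun r => H (r ^ 2) * P r)
          (2 * r * m (r ^ 2) * P r + H (r ^ 2) * V r) r := by
        intro r
        have h1 : HasDerivAt (fun r : ℝ => r ^ 2) (2 * r) r := by
          simpa using hasDerivAt_pow 2 r
        have h2 := ((hHd (r ^ 2)).comp r h1).mul (hPd r)
        refine h2.congr_deriv ?_
        simp only [Function.comp]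
        ring
      have := integral_Ioi_of_hasDerivAt_of_tendsto (a := 0) (m := 0)
        (hder 0).continuousAt.continuousWithinAt (fun r _ => hder r) (i3.add i1)
        (tendsto_const_nhds.congr' (by
          filter_upwards [eventually_ge_atTop (R + 1)] with t ht
          simp [hHz _ (hsq t ht)]))
      rw [this]
      simp [hP]
    rw [integral_add i3 i1] at hparts
    have hzero : ∫ r in Set.Ioi (0 : ℝ), 2 * r * m (r ^ 2) * (W r - P r) = 0 := by
      simp_rw [mul_sub]
      rw [integral_sub i2 i3]
      linarith
    have hsub := integral_comp_rpow_Ioi (fun u => m u • Y u) (p := 2) two_ne_zero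
    have hset : ∫ u, m u • Y u = ∫ u in Set.Ioi (0 : ℝ), m u • Y u := by
      symm
      refine setIntegral_eq_integral_of_forall_compl_eq_zero fun u hu => ?_
      have : m u = 0 := by
        by_contra hne
        exact hu (hmsub (subset_tsupport _ hne))
      simp [this]
    rw [hset, ← hsub]
    refine Eq.trans ?_ hzero
    refine setIntegral_congr_fun measurableSet_Ioi fun r hr => ?_
    have hr' : (0 : ℝ) ≤ r := le_of_lt hr
    norm_num [hY, Real.sqrt_sq hr']
    ring
  have heq : Set.EqOn Y 0 (Set.Ioi 0) := by
    refine Measure.eqOn_open_of_ae_eq (μ := volume) ?_ isOpen_Ioi hYc.continuousOn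
      continuousOn_const
    rw [Filter.EventuallyEq, ae_restrict_iff' measurableSet_Ioi]
    exact hae
  have := heq (show r ^ 2 ∈ Set.Ioi (0 : ℝ) by simpa using pow_pos hr 2)
  simp only [hY, Real.sqrt_sq hr.le, Pi.zero_apply] at this
  linarith

/-- The divergence theorem on the ball of radius `r` about the origin, in polar coordinates. -/
theorem flux_sphere_eq [Nontrivial E] (μ : Measure E) [μ.IsAddHaarMeasure]
    {ι : Type*} [Fintype ι] (e : OrthonormalBasis ι ℝ E)
    {ω : E → E →L[ℝ] ℝ} {R : ℝ} (hω : ContDiffOn ℝ 1 ω (Metric.ball 0 R)) {r : ℝ}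
    (hr : 0 < r) (hrR : r < R) :
    r ^ (Module.finrank ℝ E - 1) *
        ∫ ζ : Metric.sphere (0 : E) 1, ω (r • (ζ : E)) ζ ∂μ.toSphere =
      ∫ s in (0 : ℝ)..r, s ^ (Module.finrank ℝ E - 1) *
        ∫ ζ : Metric.sphere (0 : E) 1, covectorDiv e ω (s • (ζ : E)) ∂μ.toSphere := by
  obtain ⟨r₁, h1, h2⟩ := exists_between hrR
  obtain ⟨r₂, h3, h4⟩ := exists_between h2
  let b : ContDiffBump (0 : E) := ⟨r₁, r₂, hr.trans h1, h3⟩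
  set ω' : E → E →L[ℝ] ℝ := fun x => b x • ω x with hω'
  have hω'c : ContDiff ℝ 1 ω' := by
    rw [contDiff_iff_contDiffAt]
    intro x
    by_cases hx : x ∈ Metric.ball (0 : E) R
    · exact b.contDiffAt.smul (hω.contDiffAt (Metric.isOpen_ball.mem_nhds hx))
    · have hx' : x ∉ tsupport b := by
        rw [b.tsupport_eq]
        simp only [Metric.mem_ball, not_lt, Metric.mem_closedBall, not_le] at hx ⊢
        exact h4.trans_le hx
      have : ω' =ᶠ[𝓝 x] fun _ => 0 := by
        filter_upwards [notMem_tsupport_iff_eventuallyEq.1 hx'] with y hy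
        simp [hω', hy]
      exact contDiffAt_const.congr_of_eventuallyEq this
  have hev : ∀ x ∈ Metric.ball (0 : E) r₁, ω' =ᶠ[𝓝 x] ω := by
    intro x hx
    filter_upwards [b.eventuallyEq_one_of_mem_ball hx] with y hy
    simp [hω', hy]
  have hmem : ∀ s, 0 ≤ s → s ≤ r → ∀ ζ : Metric.sphere (0 : E) 1,
      s • (ζ : E) ∈ Metric.ball (0 : E) r₁ := by
    intro s hs hsr ζ
    rw [mem_ball_zero_iff, norm_smul, norm_eq_of_mem_sphere ζ, mul_one, Real.norm_of_nonneg hs]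
    linarith
  have main := flux_sphere_eq_of_contDiff μ e hω'c hr
  have l1 : ∀ ζ : Metric.sphere (0 : E) 1, ω' (r • (ζ : E)) ζ = ω (r • (ζ : E)) ζ := fun ζ => by
    rw [(hev _ (hmem r hr.le le_rfl ζ)).eq_of_nhds]
  simp_rw [l1] at main
  rw [main]
  refine intervalIntegral.integral_congr fun s hs => ?_
  rw [Set.uIcc_of_le hr.le] at hs
  have l2 : ∀ ζ : Metric.sphere (0 : E) 1,
      covectorDiv e ω' (s • (ζ : E)) = covectorDiv e ω (s • (ζ : E)) := fun ζ => by
    simp only [covectorDiv, (hev _ (hmem s hs.1 hs.2 ζ)).fderiv_eq]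
  simp_rw [l2]

end Divergence

/-! ### The Laplacian of a power of a solution -/

section Subsolution

variable {E F : Type*} [NormedAddCommGroup F]

/-- The regularized power `(‖f‖² + 1) ^ q`. It is as smooth as `f` for every exponent `q`, which
`‖f‖ ^ (2 * q)` need not be at the zeros of `f`, and it dominates the latter. -/
noncomputable def regPow (q : ℝ) (f : E → F) (x : E) : ℝ := (‖f x‖ ^ 2 + 1) ^ q

lemma one_le_regPow {q : ℝ} (hq : 0 ≤ q) (f : E → F) (x : E) : 1 ≤ regPow q f x :=
  Real.one_le_rpow (by nlinarith [norm_nonneg (f x)]) hq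

variable [NormedAddCommGroup E] [InnerProductSpace ℝ E] [InnerProductSpace ℝ F]

/-- The squared Hilbert–Schmidt norm of the derivative of `f`, computed in the orthonormal
basis `e`. -/
noncomputable def gradSq {ι : Type*} [Fintype ι] (e : OrthonormalBasis ι ℝ E) (f : E → F)
    (x : E) : ℝ :=
  ∑ i, ‖fderiv ℝ f x (e i)‖ ^ 2

lemma gradSq_nonneg {ι : Type*} [Fintype ι] (e : OrthonormalBasis ι ℝ E) (f : E → F) (x : E) :
    0 ≤ gradSq e f x := Finset.sum_nonneg fun _ _ => by positivity

lemma contDiffOn_regPow {q : ℝ} {f : E → F} {k : WithTop ℕ∞} {s : Set E}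
    (hf : ContDiffOn ℝ k f s) : ContDiffOn ℝ k (regPow q f) s := by
  refine ContDiffOn.rpow_const_of_ne ((hf.norm_sq ℝ).add contDiffOn_const) fun x _ => ?_
  positivity

lemma fderiv_regPow_apply {q : ℝ} {f : E → F} {x : E} (hf : DifferentiableAt ℝ f x) (v : E) :
    fderiv ℝ (regPow q f) x v =
      2 * q * (‖f x‖ ^ 2 + 1) ^ (q - 1) * inner ℝ (f x) (fderiv ℝ f x v) := by
  have h1 := hf.hasFDerivAt.norm_sq.add_const 1
  have h2 := h1.rpow_const (p := q) (Or.inl (by positivity))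
  have : HasFDerivAt (regPow q f) _ x := h2
  rw [this.fderiv]
  simp
  ring

/-- The Laplacian of `(‖f‖² + 1) ^ q`, where `⟪f, Δ f⟫` and `Δ f` are expanded in the
basis `e`. -/
lemma covectorDiv_fderiv_regPow {ι : Type*} [Fintype ι] (e : OrthonormalBasis ι ℝ E)
    {q : ℝ} {f : E → F} {x : E} (hf : ContDiffAt ℝ 2 f x) :
    covectorDiv e (fderiv ℝ (regPow q f)) x =
      4 * q * (q - 1) * (‖f x‖ ^ 2 + 1) ^ (q - 2) *
          ∑ i, inner ℝ (f x) (fderiv ℝ f x (e i)) ^ 2 +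
        2 * q * (‖f x‖ ^ 2 + 1) ^ (q - 1) *
          (gradSq e f x + inner ℝ (f x) (∑ i, fderiv ℝ (fderiv ℝ f) x (e i) (e i))) := by
  have hev : ∀ᶠ y in 𝓝 x, ContDiffAt ℝ 2 f y := hf.eventually (by simp)
  have hd : HasFDerivAt f (fderiv ℝ f x) x := (hf.differentiableAt two_ne_zero).hasFDerivAt
  have hd2 : HasFDerivAt (fderiv ℝ f) (fderiv ℝ (fderiv ℝ f) x) x :=
    ((hf.fderiv_right (m := 1) (by norm_num)).differentiableAt one_ne_zero).hasFDerivAt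
  have hΦ : ContDiffAt ℝ 2 (regPow q f) x :=
    ((hf.norm_sq ℝ).add contDiffAt_const).rpow_const_of_ne (by positivity)
  have hΦ2 : HasFDerivAt (fderiv ℝ (regPow q f)) (fderiv ℝ (fderiv ℝ (regPow q f)) x) x :=
    ((hΦ.fderiv_right (m := 1) (by norm_num)).differentiableAt one_ne_zero).hasFDerivAt
  have key : ∀ v : E, fderiv ℝ (fderiv ℝ (regPow q f)) x v v =
      4 * q * (q - 1) * (‖f x‖ ^ 2 + 1) ^ (q - 2) * inner ℝ (f x) (fderiv ℝ f x v) ^ 2 +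
        2 * q * (‖f x‖ ^ 2 + 1) ^ (q - 1) *
          (‖fderiv ℝ f x v‖ ^ 2 + inner ℝ (f x) (fderiv ℝ (fderiv ℝ f) x v v)) := by
    intro v
    have h1 := hΦ2.clm_apply (hasFDerivAt_const v x)
    have h2 := (((hd.norm_sq.add_const 1).rpow_const (p := q - 1)
      (Or.inl (by positivity))).const_mul (2 * q)).mul
        (hd.inner ℝ (hd2.clm_apply (hasFDerivAt_const v x)))
    have h3 := h1.unique (h2.congr_of_eventuallyEq (by
      filter_upwards [hev] with y hy
      exact fderiv_regPow_apply (hy.differentiableAt two_ne_zero) v))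
    have h4 := DFunLike.congr_fun h3 v
    simp only [add_apply, ContinuousLinearMap.comp_apply,
      ContinuousLinearMap.flip_apply, zero_apply, map_zero, zero_add,
      smul_apply, smul_eq_mul, fderivInnerCLM_apply,
      ContinuousLinearMap.prod_apply, innerSL_apply_apply, real_inner_self_eq_norm_sq,
      show q - 1 - 1 = q - 2 by ring, nsmul_eq_mul] at h4
    simp at h4
    rw [h4]
    ring
  simp only [covectorDiv, gradSq, key, inner_sum]
  rw [Finset.sum_add_distrib, ← Finset.mul_sum, ← Finset.mul_sum, Finset.sum_add_distrib]

/-- If `Δ f = lam • f`, then `(‖f‖² + 1) ^ q` is subharmonic, and its Laplacian is bounded by the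
gradient of `f` and the function itself. -/
lemma covectorDiv_fderiv_regPow_bounds {ι : Type*} [Fintype ι] [FiniteDimensional ℝ E]
    (e : OrthonormalBasis ι ℝ E) {q lam : ℝ} (hq : 1 ≤ q) (hlam : 0 ≤ lam) {f : E → F} {x : E}
    (hf : ContDiffAt ℝ 2 f x) (hΔ : Laplacian.laplacian f x = lam • f x) :
    0 ≤ covectorDiv e (fderiv ℝ (regPow q f)) x ∧
      covectorDiv e (fderiv ℝ (regPow q f)) x ≤
        2 * q * (2 * q - 1) * ((‖f x‖ ^ 2 + 1) ^ (q - 1) * gradSq e f x) +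
          2 * q * lam * regPow q f x := by
  have hlap : ∑ i, fderiv ℝ (fderiv ℝ f) x (e i) (e i) = lam • f x := by
    rw [← hΔ, InnerProductSpace.laplacian_eq_iteratedFDeriv_orthonormalBasis f e]
    simp [iteratedFDeriv_two_apply]
  rw [covectorDiv_fderiv_regPow e hf, hlap, inner_smul_right, real_inner_self_eq_norm_sq]
  set h := ‖f x‖ ^ 2 with hh
  have h0 : 0 ≤ h := by positivity
  have hG := gradSq_nonneg e f x
  have hS0 : 0 ≤ ∑ i, inner ℝ (f x) (fderiv ℝ f x (e i)) ^ 2 :=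
    Finset.sum_nonneg fun _ _ => sq_nonneg _
  have hS : ∑ i, inner ℝ (f x) (fderiv ℝ f x (e i)) ^ 2 ≤ (h + 1) * gradSq e f x := by
    rw [gradSq, Finset.mul_sum]
    refine Finset.sum_le_sum fun i _ => ?_
    have := abs_real_inner_le_norm (f x) (fderiv ℝ f x (e i))
    calc inner ℝ (f x) (fderiv ℝ f x (e i)) ^ 2
        = |inner ℝ (f x) (fderiv ℝ f x (e i))| ^ 2 := (sq_abs _).symm
      _ ≤ (‖f x‖ * ‖fderiv ℝ f x (e i)‖) ^ 2 := by gcongr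
      _ = h * ‖fderiv ℝ f x (e i)‖ ^ 2 := by rw [mul_pow]
      _ ≤ (h + 1) * ‖fderiv ℝ f x (e i)‖ ^ 2 := by gcongr; linarith
  set S := ∑ i, inner ℝ (f x) (fderiv ℝ f x (e i)) ^ 2
  have p2 : (h + 1) ^ (q - 2) * (h + 1) = (h + 1) ^ (q - 1) := by
    rw [← Real.rpow_add_one (by positivity)]; ring_nf
  have p1 : (h + 1) ^ (q - 1) * (h + 1) = regPow q f x := by
    rw [← Real.rpow_add_one (by positivity), regPow, sub_add_cancel]
  have P2 : 0 < (h + 1) ^ (q - 2) := by positivity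
  have P1 : 0 < (h + 1) ^ (q - 1) := by positivity
  have hq1 : 0 ≤ q - 1 := by linarith
  constructor
  · have : 0 ≤ q := by linarith
    positivity
  · have t1 : 4 * q * (q - 1) * (h + 1) ^ (q - 2) * S ≤
        4 * q * (q - 1) * ((h + 1) ^ (q - 1) * gradSq e f x) := by
      rw [← p2, mul_assoc (4 * q * (q - 1)), mul_assoc ((h + 1) ^ (q - 2))]
      gcongr
    have t2 : 2 * q * lam * ((h + 1) ^ (q - 1) * h) ≤ 2 * q * lam * regPow q f x := by
      rw [← p1]
      gcongr
      linarith
    nlinarith [t1, t2]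

end Subsolution

/-! ### Spherical means -/

section SphericalMeans

variable {E : Type*} [NormedAddCommGroup E] [InnerProductSpace ℝ E]

lemma smul_sphere_mem_ball {r : ℝ} (hr : r ∈ Set.Ioo (-1 : ℝ) 1)
    (ζ : Metric.sphere (0 : E) 1) : r • (ζ : E) ∈ Metric.ball (0 : E) 1 := by
  rw [mem_ball_zero_iff, norm_smul, norm_eq_of_mem_sphere ζ, mul_one, Real.norm_eq_abs]
  exact abs_lt.2 hr

lemma continuous_comp_smul_sphere {G : Type*} [TopologicalSpace G] {u : E → G}
    (hu : ContinuousOn u (Metric.ball 0 1)) {r : ℝ} (hr : r ∈ Set.Ioo (-1 : ℝ) 1) :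
    Continuous fun ζ : Metric.sphere (0 : E) 1 => u (r • (ζ : E)) :=
  hu.comp_continuous (by fun_prop) (smul_sphere_mem_ball hr)

variable [FiniteDimensional ℝ E] [MeasurableSpace E] [BorelSpace E]
  {ν : Measure (Metric.sphere (0 : E) 1)} [IsFiniteMeasure ν]

lemma integrable_comp_smul_sphere {u : E → ℝ}
    (hu : ContinuousOn u (Metric.ball 0 1)) {r : ℝ} (hr : r ∈ Set.Ioo (-1 : ℝ) 1) :
    Integrable (fun ζ : Metric.sphere (0 : E) 1 => u (r • (ζ : E))) ν :=
  (continuous_comp_smul_sphere hu hr).integrable_of_hasCompactSupport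
    (HasCompactSupport.of_compactSpace _)

lemma continuousOn_integral_comp_smul_sphere {u : E → ℝ}
    (hu : ContinuousOn u (Metric.ball 0 1)) :
    ContinuousOn (fun r : ℝ => ∫ ζ : Metric.sphere (0 : E) 1, u (r • (ζ : E)) ∂ν)
      (Set.Ioo (-1) 1) := by
  rw [continuousOn_iff_continuous_domRestrict]
  have : LocallyCompactSpace (Set.Ioo (-1 : ℝ) 1) := isOpen_Ioo.locallyCompactSpace
  have := continuous_parametric_integral_of_continuous (μ := ν)
    (f := fun (r : Set.Ioo (-1 : ℝ) 1) (ζ : Metric.sphere (0 : E) 1) => u ((r : ℝ) • (ζ : E)))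
    (s := Set.univ) (hu.comp_continuous (by fun_prop) fun p => smul_sphere_mem_ball p.1.2 p.2)
    isCompact_univ
  simpa [Set.domRestrict_def] using this

/-- Spherical means may be differentiated in the radius under the integral sign. -/
lemma hasDerivAt_integral_comp_smul_sphere {u : E → ℝ}
    (hu : ContDiffOn ℝ 1 u (Metric.ball 0 1)) {r : ℝ} (hr : r ∈ Set.Ioo (-1 : ℝ) 1) :
    HasDerivAt (fun r : ℝ => ∫ ζ : Metric.sphere (0 : E) 1, u (r • (ζ : E)) ∂ν)
      (∫ ζ : Metric.sphere (0 : E) 1, fderiv ℝ u (r • (ζ : E)) ζ ∂ν) r := by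
  have hdu : ContinuousOn (fderiv ℝ u) (Metric.ball 0 1) :=
    hu.continuousOn_fderiv_of_isOpen Metric.isOpen_ball le_rfl
  obtain ⟨ρ, h1, h2⟩ := exists_between (abs_lt.2 hr)
  have hsub : Metric.closedBall (0 : E) ρ ⊆ Metric.ball 0 1 := Metric.closedBall_subset_ball h2
  obtain ⟨C, hC⟩ := (isCompact_closedBall (0 : E) ρ).exists_bound_of_continuousOn (hdu.mono hsub)
  have hIoo : ∀ s ∈ Set.Ioo (-ρ) ρ, s ∈ Set.Ioo (-1 : ℝ) 1 := fun s hs =>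
    ⟨by linarith [hs.1], by linarith [hs.2]⟩
  refine (hasDerivAt_integral_of_dominated_loc_of_deriv_le (s := Set.Ioo (-ρ) ρ)
    (μ := ν) (bound := fun _ => C)
    (F := fun (r : ℝ) (ζ : Metric.sphere (0 : E) 1) => u (r • (ζ : E)))
    (F' := fun r ζ => fderiv ℝ u (r • (ζ : E)) ζ)
    (Ioo_mem_nhds (abs_lt.1 h1).1 (abs_lt.1 h1).2) ?_ ?_ ?_ ?_ ?_ ?_).2
  · filter_upwards [Ioo_mem_nhds hr.1 hr.2] with s hs
    exact (continuous_comp_smul_sphere hu.continuousOn hs).aestronglyMeasurable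
  · exact integrable_comp_smul_sphere hu.continuousOn hr
  · exact ((continuous_comp_smul_sphere hdu hr).clm_apply
      continuous_subtype_val).aestronglyMeasurable
  · refine ae_of_all _ fun ζ s hs => ?_
    refine (ContinuousLinearMap.le_opNorm _ _).trans ?_
    rw [norm_eq_of_mem_sphere ζ, mul_one]
    refine hC _ ?_
    rw [mem_closedBall_zero_iff, norm_smul, norm_eq_of_mem_sphere ζ, mul_one, Real.norm_eq_abs]
    exact (abs_lt.2 hs).le
  · exact integrable_const _
  · refine ae_of_all _ fun ζ s hs => ?_
    have h3 := ((hu.contDiffAt (Metric.isOpen_ball.mem_nhds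
      (smul_sphere_mem_ball (hIoo s hs) ζ))).differentiableAt one_ne_zero).hasFDerivAt
    have h4 : HasDerivAt (fun s : ℝ => s • (ζ : E)) (ζ : E) s := by
      simpa using (hasDerivAt_id s).smul_const (ζ : E)
    exact h3.comp_hasDerivAt s h4

/-- Hölder's inequality with exponents `1 - 1 / q` and `1 / q`; the case `q = 1` is included. -/
lemma integral_rpow_sub_one_mul_le {α : Type*} [MeasurableSpace α] {μ : Measure α}
    {a b : α → ℝ} {q : ℝ} (hq : 1 ≤ q) (ha : ∀ x, 0 ≤ a x) (hb : ∀ x, 0 ≤ b x)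
    (hai : Integrable (fun x => a x ^ q) μ) (hbi : Integrable (fun x => b x ^ q) μ) :
    ∫ x, a x ^ (q - 1) * b x ∂μ ≤
      (∫ x, a x ^ q ∂μ) ^ (1 - 1 / q) * (∫ x, b x ^ q ∂μ) ^ (1 / q) := by
  have hq0 : 0 < q := by linarith
  have h1q : 0 ≤ 1 - 1 / q := by
    rw [sub_nonneg, div_le_one hq0]; exact hq
  have hA : ∀ x, 0 ≤ a x ^ q := fun x => Real.rpow_nonneg (ha x) _
  have hB : ∀ x, 0 ≤ b x ^ q := fun x => Real.rpow_nonneg (hb x) _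
  have e : ∀ x, a x ^ (q - 1) * b x = (a x ^ q) ^ (1 - 1 / q) * (b x ^ q) ^ (1 / q) := by
    intro x
    rw [← Real.rpow_mul (ha x), ← Real.rpow_mul (hb x), mul_one_div_cancel hq0.ne', Real.rpow_one,
      mul_sub, mul_one_div_cancel hq0.ne', mul_one]
  have hol := ENNReal.lintegral_mul_norm_pow_le (μ := μ)
    (f := fun x => ENNReal.ofReal (a x ^ q)) (g := fun x => ENNReal.ofReal (b x ^ q))
    hai.aemeasurable.ennreal_ofReal hbi.aemeasurable.ennreal_ofReal
    h1q (by positivity : 0 ≤ 1 / q) (by ring)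
  have hpt : ∀ x, ENNReal.ofReal (a x ^ q) ^ (1 - 1 / q) * ENNReal.ofReal (b x ^ q) ^ (1 / q) =
      ENNReal.ofReal (a x ^ (q - 1) * b x) := by
    intro x
    rw [e x, ENNReal.ofReal_mul (Real.rpow_nonneg (hA x) _),
      ENNReal.ofReal_rpow_of_nonneg (hA x) h1q, ENNReal.ofReal_rpow_of_nonneg (hB x) (by positivity)]
  simp_rw [hpt] at hol
  rw [← ofReal_integral_eq_lintegral_ofReal hai (ae_of_all _ hA),
    ← ofReal_integral_eq_lintegral_ofReal hbi (ae_of_all _ hB),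
    ENNReal.ofReal_rpow_of_nonneg (integral_nonneg hA) h1q,
    ENNReal.ofReal_rpow_of_nonneg (integral_nonneg hB) (by positivity),
    ← ENNReal.ofReal_mul (Real.rpow_nonneg (integral_nonneg hA) _)] at hol
  rw [integral_eq_lintegral_of_nonneg_ae]
  · exact ENNReal.toReal_le_of_le_ofReal (mul_nonneg (Real.rpow_nonneg (integral_nonneg hA) _)
      (Real.rpow_nonneg (integral_nonneg hB) _)) hol
  · exact ae_of_all _ fun x => mul_nonneg (Real.rpow_nonneg (ha x) _) (hb x)
  · simp_rw [e]
    exact ((hai.aemeasurable.pow_const _).mul (hbi.aemeasurable.pow_const _)).aestronglyMeasurable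

end SphericalMeans

/-! ### A nonlinear Grönwall estimate -/

/-- A Grönwall estimate: the substitution `y = φ ^ (1 / q)` makes the differential inequality
linear. -/
lemma rpow_le_log_of_deriv_le {φ φ' : ℝ → ℝ} {q A B : ℝ} (hq : 0 < q) (hA : 0 ≤ A) (hB : 0 ≤ B)
    (hpos : ∀ r ∈ Set.Ico (0 : ℝ) 1, 0 < φ r)
    (hcont : ContinuousOn φ (Set.Ico 0 1))
    (hder : ∀ r ∈ Set.Ioo (0 : ℝ) 1, HasDerivAt φ (φ' r) r)
    (hle : ∀ r ∈ Set.Ioo (0 : ℝ) 1, φ' r ≤ A * φ r ^ (1 - 1 / q) / (1 - r) + B * φ r)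
    {r : ℝ} (hr : r ∈ Set.Ico (0 : ℝ) 1) :
    φ r ^ (1 / q) ≤ Real.exp (B / q) * (φ 0 ^ (1 / q) + A / q * Real.log (1 / (1 - r))) := by
  let z : ℝ → ℝ := fun r => φ r ^ (1 / q) * Real.exp (-(B / q * r)) + A / q * Real.log (1 - r)
  have hz : AntitoneOn z (Set.Ico 0 1) := by
    have hzd : ∀ r ∈ Set.Ioo (0 : ℝ) 1, HasDerivAt z
        ((φ' r * (1 / q) * φ r ^ (1 / q - 1)) * Real.exp (-(B / q * r)) +
          φ r ^ (1 / q) * (Real.exp (-(B / q * r)) * -(B / q * 1)) +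
            A / q * (-1 / (1 - r))) r := by
      intro r hr
      have h1 := (hder r hr).rpow_const (p := 1 / q) (Or.inl (hpos r ⟨hr.1.le, hr.2⟩).ne')
      have h2 := (((hasDerivAt_id r).const_mul (B / q)).neg).exp
      have h3 := (((hasDerivAt_id r).const_sub 1).log (by simp; linarith [hr.2])).const_mul (A / q)
      exact (h1.mul h2).add h3
    refine antitoneOn_of_deriv_nonpos (convex_Ico 0 1) ?_ ?_ ?_
    · refine ContinuousOn.add (ContinuousOn.mul ?_ (by fun_prop)) ?_
      · exact hcont.rpow_const fun x hx => Or.inl (hpos x hx).ne'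
      · refine continuousOn_const.mul (ContinuousOn.log (by fun_prop) fun x hx => ?_)
        linarith [hx.2]
    · rw [interior_Ico]
      exact fun x hx => (hzd x hx).differentiableAt.differentiableWithinAt
    · rw [interior_Ico]
      intro r hr
      rw [(hzd r hr).deriv]
      have hp := hpos r ⟨hr.1.le, hr.2⟩
      have h1r : 0 < 1 - r := by linarith [hr.2]
      have e1 : φ r ^ (1 - 1 / q) * φ r ^ (1 / q - 1) = 1 := by
        rw [← Real.rpow_add hp]; simp
      have e2 : φ r * φ r ^ (1 / q - 1) = φ r ^ (1 / q) := by
        rw [mul_comm, ← Real.rpow_add_one hp.ne']; ring_nf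
      have key : φ' r * φ r ^ (1 / q - 1) ≤ A / (1 - r) + B * φ r ^ (1 / q) := by
        calc φ' r * φ r ^ (1 / q - 1)
            ≤ (A * φ r ^ (1 - 1 / q) / (1 - r) + B * φ r) * φ r ^ (1 / q - 1) := by
              gcongr; exact hle r hr
          _ = A * (φ r ^ (1 - 1 / q) * φ r ^ (1 / q - 1)) / (1 - r) +
                B * (φ r * φ r ^ (1 / q - 1)) := by ring
          _ = _ := by rw [e1, e2, mul_one]
      have hexp : Real.exp (-(B / q * r)) ≤ 1 := by
        rw [Real.exp_le_one_iff]
        have := hr.1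
        have : 0 ≤ B / q * r := by positivity
        linarith
      have hexp0 := Real.exp_pos (-(B / q * r))
      set t := Real.exp (-(B / q * r))
      have hAr : 0 ≤ A / (1 - r) := by positivity
      have h4 : (1 / q * t) * (φ' r * φ r ^ (1 / q - 1) - B * φ r ^ (1 / q)) ≤
          (1 / q * t) * (A / (1 - r)) := by
        gcongr; linarith
      have h5 : (1 / q * t) * (A / (1 - r)) ≤ (1 / q * 1) * (A / (1 - r)) := by gcongr
      have : φ' r * (1 / q) * φ r ^ (1 / q - 1) * t + φ r ^ (1 / q) * (t * -(B / q * 1)) +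
          A / q * (-1 / (1 - r)) = (1 / q * t) * (φ' r * φ r ^ (1 / q - 1) - B * φ r ^ (1 / q)) -
            (1 / q * 1) * (A / (1 - r)) := by ring
      rw [this]
      linarith
  -- On the bounded interval `[0, 1)` the linear term costs only the factor `exp (B / q)`.
  have h := hz ⟨le_rfl, one_pos⟩ hr hr.1
  simp only [z, mul_zero, neg_zero, Real.exp_zero, mul_one, sub_zero, Real.log_one, add_zero] at h
  have h1r : 0 < 1 - r := by linarith [hr.2]
  have hlog : Real.log (1 / (1 - r)) = - Real.log (1 - r) := by rw [one_div, Real.log_inv]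
  have hlog0 : 0 ≤ Real.log (1 / (1 - r)) :=
    Real.log_nonneg ((one_le_div h1r).2 (by linarith [hr.1]))
  have h0 : 0 ≤ φ 0 ^ (1 / q) := Real.rpow_nonneg (hpos 0 ⟨le_rfl, one_pos⟩).le _
  calc φ r ^ (1 / q)
      = Real.exp (B / q * r) * (φ r ^ (1 / q) * Real.exp (-(B / q * r))) := by
        rw [mul_left_comm, ← Real.exp_add]; simp
    _ ≤ Real.exp (B / q * r) * (φ 0 ^ (1 / q) + A / q * Real.log (1 / (1 - r))) := by
        gcongr
        rw [hlog]; linarith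
    _ ≤ _ := by
        have : B / q * r ≤ B / q := mul_le_of_le_one_right (by positivity) hr.2.le
        gcongr

/-! ### Growth of solutions of `Δ f = lam f` -/

section Growth

variable {E F : Type*} [NormedAddCommGroup E] [InnerProductSpace ℝ E] [NormedAddCommGroup F]
  [InnerProductSpace ℝ F]

lemma continuousOn_gradSq {ι : Type*} [Fintype ι] (e : OrthonormalBasis ι ℝ E) {f : E → F}
    (hf : ContDiffOn ℝ 2 f (Metric.ball 0 1)) :
    ContinuousOn (gradSq e f) (Metric.ball 0 1) := by
  have hdf : ContinuousOn (fderiv ℝ f) (Metric.ball 0 1) :=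
    hf.continuousOn_fderiv_of_isOpen Metric.isOpen_ball (by norm_num)
  unfold gradSq
  fun_prop

lemma continuousOn_covectorDiv {ι : Type*} [Fintype ι] (e : OrthonormalBasis ι ℝ E)
    {ω : E → E →L[ℝ] ℝ} (hω : ContDiffOn ℝ 1 ω (Metric.ball 0 1)) :
    ContinuousOn (covectorDiv e ω) (Metric.ball 0 1) := by
  have hdf : ContinuousOn (fderiv ℝ ω) (Metric.ball 0 1) :=
    hω.continuousOn_fderiv_of_isOpen Metric.isOpen_ball le_rfl
  unfold covectorDiv
  fun_prop

variable [FiniteDimensional ℝ E] [MeasurableSpace E] [BorelSpace E]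
  {ν : Measure (Metric.sphere (0 : E) 1)} [IsProbabilityMeasure ν]

/-- Spherical means of the Laplacian of `(‖f‖² + 1) ^ q` for `Δ f = lam • f`. The gradient term is
separated from the power of `f` by Hölder's inequality. -/
lemma integral_covectorDiv_fderiv_regPow_le {ι : Type*} [Fintype ι] (e : OrthonormalBasis ι ℝ E)
    {q lam : ℝ} (hq : 1 ≤ q) (hlam : 0 ≤ lam) {f : E → F}
    (hf : ContDiffOn ℝ 2 f (Metric.ball 0 1))
    (hΔ : ∀ x ∈ Metric.ball (0 : E) 1, Laplacian.laplacian f x = lam • f x)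
    {s : ℝ} (hs : s ∈ Set.Ioo (-1 : ℝ) 1) :
    ∫ ζ : Metric.sphere (0 : E) 1, covectorDiv e (fderiv ℝ (regPow q f)) (s • (ζ : E)) ∂ν ≤
      2 * q * (2 * q - 1) *
          ((∫ ζ : Metric.sphere (0 : E) 1, regPow q f (s • (ζ : E)) ∂ν) ^ (1 - 1 / q) *
            (∫ ζ : Metric.sphere (0 : E) 1, gradSq e f (s • (ζ : E)) ^ q ∂ν) ^ (1 / q)) +
        2 * q * lam * ∫ ζ : Metric.sphere (0 : E) 1, regPow q f (s • (ζ : E)) ∂ν := by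
  have hfc := hf.continuousOn
  have hgc := continuousOn_gradSq e hf
  have hΦc : ContinuousOn (regPow q f) (Metric.ball 0 1) := (contDiffOn_regPow hf).continuousOn
  have hωd : ContDiffOn ℝ 1 (fderiv ℝ (regPow q f)) (Metric.ball 0 1) :=
    (contDiffOn_regPow hf).fderiv_of_isOpen Metric.isOpen_ball (by norm_num)
  have hgq : ContinuousOn (fun x => gradSq e f x ^ q) (Metric.ball 0 1) :=
    hgc.rpow_const fun x _ => Or.inr (by linarith)
  have hmix : ContinuousOn (fun x => (‖f x‖ ^ 2 + 1) ^ (q - 1) * gradSq e f x)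
      (Metric.ball 0 1) := by
    refine ContinuousOn.mul (ContinuousOn.rpow_const (by fun_prop) fun x _ => Or.inl ?_) hgc
    positivity
  have i0 := integrable_comp_smul_sphere (ν := ν) (continuousOn_covectorDiv e hωd) hs
  have i1 := (integrable_comp_smul_sphere (ν := ν) hmix hs).const_mul (2 * q * (2 * q - 1))
  have i2 := (integrable_comp_smul_sphere (ν := ν) hΦc hs).const_mul (2 * q * lam)
  have hol := integral_rpow_sub_one_mul_le (μ := ν)
    (a := fun ζ : Metric.sphere (0 : E) 1 => ‖f (s • (ζ : E))‖ ^ 2 + 1)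
    (b := fun ζ => gradSq e f (s • (ζ : E))) hq (fun _ => by positivity)
    (fun _ => gradSq_nonneg _ _ _) (integrable_comp_smul_sphere hΦc hs)
    (integrable_comp_smul_sphere hgq hs)
  have hq2 : 0 ≤ 2 * q * (2 * q - 1) := mul_nonneg (by linarith) (by linarith)
  calc _ ≤ _ := integral_mono i0 (i1.add i2) fun ζ =>
        (covectorDiv_fderiv_regPow_bounds e hq hlam
          (hf.contDiffAt (Metric.isOpen_ball.mem_nhds (smul_sphere_mem_ball hs ζ)))
          (hΔ _ (smul_sphere_mem_ball hs ζ))).2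
    _ = _ := integral_add i1 i2
    _ ≤ _ := by
        rw [integral_const_mul, integral_const_mul]
        gcongr
        exact hol

/-- Integrated growth estimate for solutions of `Δ f = lam • f` whose gradient has spherical means
`O (1 / (1 - r))`. -/
theorem integral_regPow_rpow_le [Nontrivial E] (μ : Measure E) [μ.IsAddHaarMeasure]
    {c : ENNReal} (hν : ν = c • μ.toSphere)
    {ι : Type*} [Fintype ι] (e : OrthonormalBasis ι ℝ E)
    {q lam K : ℝ} (hq : 1 ≤ q) (hlam : 0 ≤ lam) (hK : 0 ≤ K) {f : E → F}
    (hf : ContDiffOn ℝ 2 f (Metric.ball 0 1))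
    (hΔ : ∀ x ∈ Metric.ball (0 : E) 1, Laplacian.laplacian f x = lam • f x)
    (hgrad : ∀ s ∈ Set.Ico (0 : ℝ) 1,
      (∫ ζ : Metric.sphere (0 : E) 1, gradSq e f (s • (ζ : E)) ^ q ∂ν) ^ (1 / q) ≤
        K / (1 - s) ^ 2) {r : ℝ} (hr : r ∈ Set.Ico (0 : ℝ) 1) :
    (∫ ζ : Metric.sphere (0 : E) 1, regPow q f (r • (ζ : E)) ∂ν) ^ (1 / q) ≤
      Real.exp (2 * q * lam / q) * (‖f 0‖ ^ 2 + 1 +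
        2 * q * (2 * q - 1) * K / q * Real.log (1 / (1 - r))) := by
  have hq0 : 0 < q := by linarith
  have hq2 : 0 ≤ 2 * q * (2 * q - 1) := mul_nonneg (by linarith) (by linarith)
  set φ : ℝ → ℝ := fun r => ∫ ζ : Metric.sphere (0 : E) 1, regPow q f (r • (ζ : E)) ∂ν with hφ
  set φ' : ℝ → ℝ := fun r => ∫ ζ : Metric.sphere (0 : E) 1,
    fderiv ℝ (regPow q f) (r • (ζ : E)) ζ ∂ν with hφ'
  set D : ℝ → ℝ := fun s => ∫ ζ : Metric.sphere (0 : E) 1,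
    covectorDiv e (fderiv ℝ (regPow q f)) (s • (ζ : E)) ∂ν with hD
  set N := Module.finrank ℝ E - 1
  have hΦ2 : ContDiffOn ℝ 2 (regPow q f) (Metric.ball 0 1) := contDiffOn_regPow hf
  have hωd : ContDiffOn ℝ 1 (fderiv ℝ (regPow q f)) (Metric.ball 0 1) :=
    hΦ2.fderiv_of_isOpen Metric.isOpen_ball (by norm_num)
  have hmem : ∀ {s : ℝ}, s ∈ Set.Ico (0 : ℝ) 1 → s ∈ Set.Ioo (-1 : ℝ) 1 := fun hs =>
    ⟨by linarith [hs.1], hs.2⟩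
  have hder : ∀ s ∈ Set.Ico (0 : ℝ) 1, HasDerivAt φ (φ' s) s := fun s hs =>
    hasDerivAt_integral_comp_smul_sphere (hΦ2.of_le (by norm_num)) (hmem hs)
  have hcont : ContinuousOn φ (Set.Ico 0 1) := fun s hs =>
    (hder s hs).continuousAt.continuousWithinAt
  have hDc : ContinuousOn D (Set.Ioo (-1) 1) :=
    continuousOn_integral_comp_smul_sphere (continuousOn_covectorDiv e hωd)
  have hD0 : ∀ s ∈ Set.Ico (0 : ℝ) 1, 0 ≤ D s := fun s hs => integral_nonneg fun ζ =>
    (covectorDiv_fderiv_regPow_bounds e hq hlam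
      (hf.contDiffAt (Metric.isOpen_ball.mem_nhds (smul_sphere_mem_ball (hmem hs) ζ)))
      (hΔ _ (smul_sphere_mem_ball (hmem hs) ζ))).1
  have hflux : ∀ s ∈ Set.Ioo (0 : ℝ) 1, s ^ N * φ' s = ∫ t in (0 : ℝ)..s, t ^ N * D t := by
    intro s hs
    have h := flux_sphere_eq μ e hωd hs.1 hs.2
    simp only [hφ', hD, hν, integral_smul_measure, smul_eq_mul, mul_left_comm _ c.toReal,
      intervalIntegral.integral_const_mul]
    rw [h]
  have hφ1 : ∀ s ∈ Set.Ico (0 : ℝ) 1, 1 ≤ φ s := by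
    intro s hs
    have := integral_mono (μ := ν) (integrable_const (1 : ℝ))
      (integrable_comp_smul_sphere hΦ2.continuousOn (hmem hs))
      fun ζ => one_le_regPow hq0.le f (s • (ζ : E))
    simpa using this
  have hφ'0 : ∀ s ∈ Set.Ioo (0 : ℝ) 1, 0 ≤ φ' s := by
    intro s hs
    have h1 : 0 ≤ s ^ N * φ' s := by
      rw [hflux s hs]
      refine intervalIntegral.integral_nonneg hs.1.le fun t ht => ?_
      exact mul_nonneg (pow_nonneg ht.1 _) (hD0 t ⟨ht.1, ht.2.trans_lt hs.2⟩)
    exact nonneg_of_mul_nonneg_right h1 (pow_pos hs.1 _)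
  have hmono : MonotoneOn φ (Set.Ico 0 1) := by
    refine monotoneOn_of_deriv_nonneg (convex_Ico 0 1) hcont ?_ ?_
    · rw [interior_Ico]
      exact fun s hs => (hder s ⟨hs.1.le, hs.2⟩).differentiableAt.differentiableWithinAt
    · rw [interior_Ico]
      intro s hs
      rw [(hder s ⟨hs.1.le, hs.2⟩).deriv]
      exact hφ'0 s hs
  have hDle : ∀ s ∈ Set.Ico (0 : ℝ) 1, ∀ t ∈ Set.Icc 0 s, D t ≤
      2 * q * (2 * q - 1) * K * φ s ^ (1 - 1 / q) * (1 / (1 - t) ^ 2) + 2 * q * lam * φ s := by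
    intro s hs t ht
    have ht' : t ∈ Set.Ico (0 : ℝ) 1 := ⟨ht.1, ht.2.trans_lt hs.2⟩
    have h1 := integral_covectorDiv_fderiv_regPow_le (ν := ν) e hq hlam hf hΔ (hmem ht')
    have hφt : φ t ≤ φ s := hmono ht' hs ht.2
    have hφt0 : 0 ≤ φ t := zero_le_one.trans (hφ1 t ht')
    have h1q : 0 ≤ 1 - 1 / q := by rw [sub_nonneg, div_le_one hq0]; exact hq
    have hJ0 : 0 ≤ (∫ ζ : Metric.sphere (0 : E) 1, gradSq e f (t • (ζ : E)) ^ q ∂ν) ^ (1 / q) :=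
      Real.rpow_nonneg (integral_nonneg fun ζ => Real.rpow_nonneg (gradSq_nonneg _ _ _) _) _
    calc D t ≤ 2 * q * (2 * q - 1) * (φ t ^ (1 - 1 / q) *
            (∫ ζ : Metric.sphere (0 : E) 1, gradSq e f (t • (ζ : E)) ^ q ∂ν) ^ (1 / q)) +
          2 * q * lam * φ t := h1
      _ ≤ 2 * q * (2 * q - 1) * (φ s ^ (1 - 1 / q) * (K / (1 - t) ^ 2)) +
          2 * q * lam * φ s := by
          have hφs : 0 ≤ φ s ^ (1 - 1 / q) := Real.rpow_nonneg (hφt0.trans hφt) _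
          have := hgrad t ht'
          gcongr
      _ = _ := by ring
  have hφ0 : φ 0 ^ (1 / q) = ‖f 0‖ ^ 2 + 1 := by
    simp only [hφ, zero_smul, integral_const, probReal_univ, one_smul, regPow]
    rw [← Real.rpow_mul (by positivity), mul_one_div_cancel hq0.ne', Real.rpow_one]
  rw [← hφ0]
  refine rpow_le_log_of_deriv_le (φ' := φ') hq0 (mul_nonneg hq2 hK) (by positivity)
    (fun s hs => one_pos.trans_le (hφ1 s hs)) hcont (fun s hs => hder s ⟨hs.1.le, hs.2⟩) ?_ hr
  intro s hs
  have hs' : s ∈ Set.Ico (0 : ℝ) 1 := ⟨hs.1.le, hs.2⟩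
  have h1s : 0 < 1 - s := by linarith [hs.2]
  set A := 2 * q * (2 * q - 1) * K * φ s ^ (1 - 1 / q) with hA
  set B := 2 * q * lam * φ s with hB
  have hφs : 0 ≤ φ s := zero_le_one.trans (hφ1 s hs')
  have hA0 : 0 ≤ A := mul_nonneg (mul_nonneg hq2 hK) (Real.rpow_nonneg hφs _)
  have hB0 : 0 ≤ B := by positivity
  have hne : ∀ t ∈ Set.Icc 0 s, (1 : ℝ) - t ≠ 0 := fun t ht => by linarith [ht.2]
  have hic : ContinuousOn (fun t : ℝ => 1 / (1 - t) ^ 2) (Set.Icc 0 s) :=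
    continuousOn_const.div (by fun_prop) fun t ht => pow_ne_zero 2 (hne t ht)
  have hint : ∫ t in (0 : ℝ)..s, 1 / (1 - t) ^ 2 = 1 / (1 - s) - 1 := by
    have hd : ∀ t ∈ Set.uIcc 0 s, HasDerivAt (fun t : ℝ => 1 / (1 - t)) (1 / (1 - t) ^ 2) t := by
      intro t ht
      rw [Set.uIcc_of_le hs.1.le] at ht
      simpa [Pi.inv_def] using ((hasDerivAt_id t).const_sub 1).inv (hne t ht)
    rw [intervalIntegral.integral_eq_sub_of_hasDerivAt hd]
    · simp
    · exact ContinuousOn.intervalIntegrable (by rwa [Set.uIcc_of_le hs.1.le])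
  have hbound : s ^ N * φ' s ≤ s ^ N * (A / (1 - s) + B) := by
    rw [hflux s hs]
    calc ∫ t in (0 : ℝ)..s, t ^ N * D t
        ≤ ∫ t in (0 : ℝ)..s, s ^ N * (A * (1 / (1 - t) ^ 2) + B) := by
          refine intervalIntegral.integral_mono_on hs.1.le ?_ ?_ fun t ht => ?_
          · refine ContinuousOn.intervalIntegrable ?_
            rw [Set.uIcc_of_le hs.1.le]
            exact (by fun_prop : ContinuousOn (fun t : ℝ => t ^ N) _).mul
              (hDc.mono fun t ht => hmem ⟨ht.1, ht.2.trans_lt hs.2⟩)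
          · refine ContinuousOn.intervalIntegrable ?_
            rw [Set.uIcc_of_le hs.1.le]
            exact continuousOn_const.mul ((continuousOn_const.mul hic).add continuousOn_const)
          · have h0 := hD0 t ⟨ht.1, ht.2.trans_lt hs.2⟩
            have h1 := hDle s hs' t ht
            have h2 : t ^ N ≤ s ^ N := pow_le_pow_left₀ ht.1 ht.2 N
            exact mul_le_mul h2 h1 h0 (pow_nonneg hs.1.le _)
      _ = s ^ N * (A * (1 / (1 - s) - 1) + s * B) := by
          rw [intervalIntegral.integral_const_mul, intervalIntegral.integral_add,
            intervalIntegral.integral_const_mul, hint, intervalIntegral.integral_const]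
          · simp
          · refine ContinuousOn.intervalIntegrable ?_
            rw [Set.uIcc_of_le hs.1.le]
            exact continuousOn_const.mul hic
          · exact intervalIntegrable_const
      _ ≤ s ^ N * (A / (1 - s) + B) := by
          refine mul_le_mul_of_nonneg_left ?_ (pow_nonneg hs.1.le _)
          have : s * B ≤ B := mul_le_of_le_one_left hB0 hs.2.le
          rw [mul_sub, mul_one_div]
          linarith
  exact le_of_mul_le_mul_left hbound (pow_pos hs.1 _)

end Growth

/-! ### The unit ball of `ℂⁿ` -/

section ComplexBall

/-- The real orthonormal basis of `ℂⁿ` formed by the `x_k` and `y_k` directions. -/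
noncomputable def realBasisCn (n : ℕ) : OrthonormalBasis ((_ : Fin n) × Fin 2) ℝ (Cn n) :=
  Pi.orthonormalBasis fun _ => Complex.orthonormalBasisOneI

lemma gradSq_realBasisCn {n : ℕ} (f : Cn n → ℂ) (z : Cn n) :
    gradSq (realBasisCn n) f z = 2 * ‖complexGradient f z‖ ^ 2 := by
  have hpar : ∀ a b : ℂ, ‖a‖ ^ 2 + ‖b‖ ^ 2 =
      2 * (‖(a - Complex.I * b) / 2‖ ^ 2 + ‖(a + Complex.I * b) / 2‖ ^ 2) := by
    intro a b
    have h := parallelogram_law_with_norm ℝ a (Complex.I * b)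
    have hI : ‖Complex.I * b‖ = ‖b‖ := by simp
    rw [hI] at h
    simp only [norm_div, Complex.norm_ofNat, div_pow]
    nlinarith [h]
  rw [complexGradient, WithLp.prod_norm_sq_eq_of_L2]
  simp only [EuclideanSpace.norm_sq_eq, wirtinger, wirtingerConj]
  rw [← Finset.sum_add_distrib, Finset.mul_sum, gradSq, Fintype.sum_sigma]
  refine Finset.sum_congr rfl fun k _ => ?_
  rw [Fin.sum_univ_two]
  refine Eq.trans ?_ (hpar (partialX f k z) (partialY f k z))
  simp only [realBasisCn, Pi.orthonormalBasis_apply, Complex.coe_orthonormalBasisOneI]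
  rfl

instance sphereMeasure_isProbabilityMeasure {n : ℕ} [NeZero n] :
    IsProbabilityMeasure (sphereMeasure n) := by
  constructor
  rw [sphereMeasure, Measure.smul_apply, smul_eq_mul]
  refine ENNReal.inv_mul_cancel ?_ (measure_ne_top _ _)
  rw [Ne, Measure.measure_univ_eq_zero]
  exact Measure.toSphere_ne_zero _

lemma integral_gradSq_rpow_eq {n : ℕ} {p : ℝ} (hp : 0 < p) (f : Cn n → ℂ) (r : ℝ) :
    (∫ ζ : Metric.sphere (0 : Cn n) 1, gradSq (realBasisCn n) f (r • (ζ : Cn n)) ^ (p / 2)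
      ∂(sphereMeasure n)) ^ (1 / (p / 2)) = 2 * integralMean p r (complexGradient f) ^ 2 := by
  have h1 : ∀ z, gradSq (realBasisCn n) f z ^ (p / 2) =
      2 ^ (p / 2) * ‖complexGradient f z‖ ^ p := by
    intro z
    rw [gradSq_realBasisCn, Real.mul_rpow (by norm_num) (by positivity), ← Real.rpow_natCast,
      ← Real.rpow_mul (norm_nonneg _)]
    congr 2
    push_cast; ring
  have h0 : 0 ≤ ∫ ζ : Metric.sphere (0 : Cn n) 1, ‖complexGradient f (r • (ζ : Cn n))‖ ^ p
      ∂(sphereMeasure n) := integral_nonneg fun _ => by positivity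
  simp_rw [h1]
  rw [integral_const_mul, Real.mul_rpow (by positivity) h0, ← Real.rpow_mul (by norm_num),
    mul_one_div_cancel (by positivity), Real.rpow_one, integralMean, ← Real.rpow_natCast,
    ← Real.rpow_mul h0]
  congr 2
  push_cast; field_simp

end ComplexBall

theorem corollary1p2 (n : ℕ) (hn : 1 ≤ n) (p : ℝ) (hp : 2 ≤ p)
    (lam : ℝ) (hlam₀ : 0 ≤ lam) (hlam : lam < 4 * (n : ℝ) / p)
    (f : Cn n → ℂ) (hf : IsYukawaSolution lam f)
    (hgrad : (fun r : ℝ => integralMean p r (complexGradient f)) =O[𝓝[<] (1 : ℝ)]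
      fun r : ℝ => 1 / (1 - r)) :
    (fun r : ℝ => integralMean p r f) =O[𝓝[<] (1 : ℝ)]
      fun r : ℝ => (Real.log (1 / (1 - r))) ^ (1 / 2 : ℝ) := by
  have : NeZero n := ⟨by omega⟩
  have hp0 : 0 < p := by linarith
  set q := p / 2 with hq
  have hq1 : 1 ≤ q := by rw [hq]; linarith
  have hq0 : 0 < q := by linarith
  have hf2 := hf.1
  have hΔ : ∀ x ∈ Metric.ball (0 : Cn n) 1, Laplacian.laplacian f x = lam • f x := fun x hx => by
    rw [hf.2 x hx, Complex.real_smul]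
  set e := realBasisCn n
  set J : ℝ → ℝ := fun s => (∫ ζ : Metric.sphere (0 : Cn n) 1, gradSq e f (s • (ζ : Cn n)) ^ q
    ∂(sphereMeasure n)) ^ (1 / q) with hJ
  -- The hypothesis controls the gradient near the boundary; inside, compactness does.
  obtain ⟨K, hK0, hK⟩ : ∃ K : ℝ, 0 ≤ K ∧ ∀ s ∈ Set.Ico (0 : ℝ) 1, J s ≤ K / (1 - s) ^ 2 := by
    obtain ⟨c, hc⟩ := hgrad.bound
    obtain ⟨r₀, hr₀, hr₀c⟩ := (mem_nhdsLT_iff_exists_Ioo_subset).1 hc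
    have hr₁ : max r₀ 0 < 1 := max_lt hr₀ one_pos
    have hJc : ContinuousOn J (Set.Icc 0 (max r₀ 0)) := by
      refine ContinuousOn.rpow_const ?_ fun _ _ => Or.inr (by positivity)
      refine (continuousOn_integral_comp_smul_sphere (ν := sphereMeasure n)
        ((continuousOn_gradSq e hf2).rpow_const fun _ _ => Or.inr hq0.le)).mono fun s hs => ?_
      exact ⟨by linarith [hs.1], hs.2.trans_lt hr₁⟩
    obtain ⟨C, hC⟩ := isCompact_Icc.exists_bound_of_continuousOn hJc
    refine ⟨max C (2 * c ^ 2), le_max_of_le_right (by positivity), fun s hs => ?_⟩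
    have h1s : 0 < 1 - s := by linarith [hs.2]
    by_cases hsr : s ≤ max r₀ 0
    · have h1 : J s ≤ C := (le_abs_self _).trans (hC s ⟨hs.1, hsr⟩)
      have h2 : 0 ≤ max C (2 * c ^ 2) := le_max_of_le_right (by positivity)
      have h3 : (1 - s) ^ 2 ≤ 1 := pow_le_one₀ h1s.le (by linarith [hs.1])
      rw [le_div_iff₀ (by positivity)]
      have h4 : max C (2 * c ^ 2) * (1 - s) ^ 2 ≤ max C (2 * c ^ 2) :=
        mul_le_of_le_one_right h2 h3
      have h5 : J s * (1 - s) ^ 2 ≤ J s := mul_le_of_le_one_right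
        (Real.rpow_nonneg (integral_nonneg fun _ => Real.rpow_nonneg (gradSq_nonneg _ _ _) _) _) h3
      linarith [le_max_left C (2 * c ^ 2)]
    · have h1 := hr₀c ⟨(le_max_left _ _).trans_lt (not_le.1 hsr), hs.2⟩
      simp only [Set.mem_ofPred_eq, Real.norm_eq_abs, abs_of_pos (one_div_pos.2 h1s)] at h1
      calc J s = 2 * |integralMean p s (complexGradient f)| ^ 2 := by
            rw [sq_abs]; exact integral_gradSq_rpow_eq hp0 f s
        _ ≤ 2 * (c * (1 / (1 - s))) ^ 2 := by gcongr
        _ = 2 * c ^ 2 / (1 - s) ^ 2 := by field_simp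
        _ ≤ _ := by gcongr; exact le_max_right _ _
  have main := fun r hr => integral_regPow_rpow_le (ν := sphereMeasure n)
    (volume : Measure (Cn n)) rfl e hq1 hlam₀ hK0 hf2 hΔ hK (r := r) hr
  set a := Real.exp (2 * q * lam / q) * (‖f 0‖ ^ 2 + 1) with ha
  set b := Real.exp (2 * q * lam / q) * (2 * q * (2 * q - 1) * K / q) with hb
  have ha0 : 0 ≤ a := by positivity
  have hb0 : 0 ≤ b := by
    have : 0 ≤ 2 * q - 1 := by linarith
    positivity
  refine IsBigO.of_bound ((a + b) ^ (1 / 2 : ℝ)) ?_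
  -- For `r > 1 - 1 / e` the logarithm is at least `1` and absorbs the additive constant.
  have hlt : 1 - Real.exp (-1) < 1 := by linarith [Real.exp_pos (-1)]
  have hnonneg : 0 ≤ 1 - Real.exp (-1) := by
    rw [sub_nonneg, Real.exp_le_one_iff]; norm_num
  filter_upwards [Ioo_mem_nhdsLT hlt] with r hr
  have hr' : r ∈ Set.Ico (0 : ℝ) 1 := ⟨by linarith [hr.1], hr.2⟩
  have hrm : r ∈ Set.Ioo (-1 : ℝ) 1 := ⟨by linarith [hr'.1], hr.2⟩
  have h1r : 0 < 1 - r := by linarith [hr.2]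
  set L := Real.log (1 / (1 - r)) with hL
  have hL1 : 1 ≤ L := by
    rw [hL, one_div, Real.log_inv, le_neg, Real.log_le_iff_le_exp h1r]
    linarith [hr.1]
  have hM0 : 0 ≤ integralMean p r f := Real.rpow_nonneg (integral_nonneg fun _ => by positivity) _
  rw [Real.norm_of_nonneg hM0, Real.norm_of_nonneg (by positivity),
    ← Real.mul_rpow (by positivity) (by positivity)]
  have hpow : ∀ z, ‖f z‖ ^ p ≤ regPow q f z := by
    intro z
    calc ‖f z‖ ^ p = (‖f z‖ ^ 2) ^ q := by
          rw [← Real.rpow_natCast, ← Real.rpow_mul (norm_nonneg _), hq]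
          congr 1; push_cast; ring
      _ ≤ regPow q f z := by
          unfold regPow
          gcongr
          linarith
  have hfp : ContinuousOn (fun z => ‖f z‖ ^ p) (Metric.ball 0 1) :=
    hf2.continuousOn.norm.rpow_const fun _ _ => Or.inr hp0.le
  set φ := ∫ ζ : Metric.sphere (0 : Cn n) 1, regPow q f (r • (ζ : Cn n)) ∂(sphereMeasure n) with hφ
  have hφ0 : 0 ≤ φ := integral_nonneg fun ζ => zero_le_one.trans (one_le_regPow hq0.le f _)
  have hle : ∫ ζ : Metric.sphere (0 : Cn n) 1, ‖f (r • (ζ : Cn n))‖ ^ p ∂(sphereMeasure n) ≤ φ :=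
    integral_mono (integrable_comp_smul_sphere hfp hrm)
      (integrable_comp_smul_sphere (contDiffOn_regPow hf2).continuousOn hrm) fun ζ => hpow _
  calc integralMean p r f ≤ φ ^ (1 / p) :=
        Real.rpow_le_rpow (integral_nonneg fun _ => by positivity) hle (by positivity)
    _ = (φ ^ (1 / q)) ^ (1 / 2 : ℝ) := by
        rw [← Real.rpow_mul hφ0, hq]
        congr 1; field_simp
    _ ≤ ((a + b) * L) ^ (1 / 2 : ℝ) := by
        refine Real.rpow_le_rpow (by positivity) ?_ (by norm_num)
        have hm := main r hr'
        have : a ≤ a * L := le_mul_of_one_le_right ha0 hL1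
        calc φ ^ (1 / q) ≤ a + b * L := hm.trans_eq (by rw [ha, hb]; ring)
          _ ≤ (a + b) * L := by rw [add_mul]; linarith
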